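/- Let $\eta$ be a Poisson point process on $\mathbb R^d$, regarded as a random locally finite set of points, whose intensity measure $\mu$ is non-zero, locally finite and has no atoms. Let $k\ge 1$, let $f:(\mathbb R^d)^k\to[0,\infty)$ be measurable and symmetric, and let $$F=\sum_{(x_1,\dots,x_k)} f(x_1,\dots,x_k),$$ where the sum is over all $k$-tuples of pairwise distinct points of $\eta$; assume that $F<\infty$ almost surely. Suppose that there are constants $\rho_F>0$, $\Theta_F\ge 1$ and $M_F\ge m_F>0$ such that for all $x_1,\dots,x_k\in\mathbb R^d$: (K1) $f(x_1,\dots,x_k)>0$ whenever $\operatorname{diam}\{x_1,\dots,x_k\}\le\rho_F$; (K2) $f(x_1,\dots,x_k)=0$ whenever $\operatorname{diam}\{x_1,\dots,x_k\}>\Theta_F\,\rho_F$; (K3) $m_F\le f(x_1,\dots,x_k)\le M_F$ whenever $f(x_1,\dots,x_k)>0$. Let $M$ be either the mean or a median of $F$, let $I:[0,\infty)\to\mathbb R$ be a function such that $$\mathbb P(F\ge M+r)\le \exp(-I(r))\qquad\text{for all } r\ge 0,$$ and let $a>0$ be such that $\liminf_{r\to\infty} I(r)/r^a>0$ (the value $+\infty$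 is allowed). Then $a\le 1/k$. -/

import Mathlib

open MeasureTheory ProbabilityTheory
open scoped ENNReal

noncomputable section

namespace PoissonUStat

/-- A locally finite point configuration in `ℝ^d`: a set of points which has
only finitely many points in each bounded set. -/
structure Config (d : ℕ) where
  /-- The set of points of the configuration. -/
  points : Set (EuclideanSpace ℝ (Fin d))
  /-- Every bounded set contains only finitely many points. -/
  finite_inter : ∀ B : Set (EuclideanSpace ℝ (Fin d)),
    Bornology.IsBounded B → (points ∩ B).Finite

/-- The number `ξ(A)` of points of the configuration `ξ` in `A`, possibly infinite. -/
def Config.count {d : ℕ} (ξ : Config d) (A : Set (EuclideanSpace ℝ (Fin d))) : ℕ∞ :=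
  (ξ.points ∩ A).encard

/-- The σ-algebra on configurations generated by the maps `ξ ↦ ξ(A)`, `A` Borel
(the countable set of values carries its power set as σ-algebra). -/
instance instMeasurableSpaceConfig (d : ℕ) : MeasurableSpace (Config d) :=
  ⨆ A : {A : Set (EuclideanSpace ℝ (Fin d)) // MeasurableSet A},
    MeasurableSpace.comap (fun ξ : Config d => ξ.count A.1) ⊤

/-- `η` is a Poisson point process with intensity measure `μ`, on the probability space
`(Ω, P)`: a random configuration such that the number of points in a Borel set `A` is Poisson
distributed with mean `μ(A)` and such that the numbers of points in pairwise disjoint Borel sets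
are independent. (For the locally finite measures considered, the sets `A` of finite measure
determine everything: if `μ(A) = ∞`, then `η(A) = ∞` almost surely by independence.) -/
structure IsPoissonProcess {d : ℕ} {Ω : Type*} [MeasurableSpace Ω] (P : Measure Ω)
    (η : Ω → Config d) (μ : Measure (EuclideanSpace ℝ (Fin d))) : Prop where
  measurable : Measurable η
  prob_count_eq : ∀ A : Set (EuclideanSpace ℝ (Fin d)), MeasurableSet A → μ A ≠ ∞ →
    ∀ n : ℕ, P {ω | (η ω).count A = (n : ℕ∞)} = poissonMeasure (μ A).toNNReal {n}
  indep_count : ∀ (n : ℕ) (A : Fin n → Set (EuclideanSpace ℝ (Fin d))),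
    (∀ i, MeasurableSet (A i)) → (∀ i j, i ≠ j → Disjoint (A i) (A j)) →
    iIndepFun (m := fun _ => (⊤ : MeasurableSpace ℕ∞)) (fun i ω => (η ω).count (A i)) P

/-- The set of `k`-tuples of pairwise distinct points of `ξ`. -/
def Config.distinctTuples {d : ℕ} (ξ : Config d) (k : ℕ) :
    Set (Fin k → EuclideanSpace ℝ (Fin d)) :=
  {x | (∀ i, x i ∈ ξ.points) ∧ Function.Injective x}

/-- The U-statistic of order `k` with a nonnegative kernel `f`: the sum, with values in
`[0, ∞]`, of `f` over all `k`-tuples of distinct points of the configuration. -/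
def uStat {d k : ℕ} (f : (Fin k → EuclideanSpace ℝ (Fin d)) → ℝ) (ξ : Config d) : EReal :=
  ((∑' x : ξ.distinctTuples k, ENNReal.ofReal (f x) : ℝ≥0∞) : EReal)

/-- A (nonnegative) kernel: a symmetric, measurable, nonnegative function. -/
structure IsKernel {d k : ℕ} (f : (Fin k → EuclideanSpace ℝ (Fin d)) → ℝ) : Prop where
  symmetric : ∀ (σ : Equiv.Perm (Fin k)) (x : Fin k → EuclideanSpace ℝ (Fin d)),
    f (fun i => x (σ i)) = f x
  measurable : Measurable f
  nonneg : ∀ x, 0 ≤ f x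

/-- `f` is positive on all tuples of diameter at most `ρ`. -/
def CondK1 {d k : ℕ} (f : (Fin k → EuclideanSpace ℝ (Fin d)) → ℝ) (ρ : ℝ) : Prop :=
  ∀ x, Metric.diam (Set.range x) ≤ ρ → 0 < f x

/-- `f` vanishes on all tuples of diameter larger than `Θ * ρ`. -/
def CondK2 {d k : ℕ} (f : (Fin k → EuclideanSpace ℝ (Fin d)) → ℝ) (ρ Θ : ℝ) : Prop :=
  ∀ x, Θ * ρ < Metric.diam (Set.range x) → f x = 0

/-- Where `f` is positive, it lies between `m` and `M`. -/
def CondK3 {d k : ℕ} (f : (Fin k → EuclideanSpace ℝ (Fin d)) → ℝ) (m M : ℝ) : Prop :=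
  ∀ x, 0 < f x → m ≤ f x ∧ f x ≤ M

/-- The real number `M` is the mean of the almost surely finite random variable `X`.
(Integrability is not required separately: an almost surely finite U-statistic as considered
here has moments of all orders, so for it the integral is the true expectation.) -/
def IsMean {Ω : Type*} [MeasurableSpace Ω] (P : Measure Ω) (X : Ω → EReal) (M : ℝ) : Prop :=
  M = ∫ ω, (X ω).toReal ∂P

/-- The real number `M` is a median of the random variable `X`. -/
def IsMedian {Ω : Type*} [MeasurableSpace Ω] (P : Measure Ω) (X : Ω → EReal) (M : ℝ) : Prop :=
  1 / 2 ≤ P {ω | X ω ≤ (M : EReal)} ∧ 1 / 2 ≤ P {ω | (M : EReal) ≤ X ω}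

end PoissonUStat

end

/-!
Clusters of points force the heavy tail. Fix a ball `B` of radius `ρ / 2` with
`0 < λ = μ(B) < ∞`. By (K1) and (K3) the kernel is at least `m` on every `k`-tuple of points in
`B`, so if `B` contains exactly `n` points, then
`F ≥ m n (n - 1) ⋯ (n - k + 1) ≥ m (n / 2) ^ k` for `n ≥ 2 k`
(`le_uStat_of_count_eq`). This has probability `exp (-λ) λ ^ n / n!`, which is at least
`exp (-(λ + n |log λ| + n log n))`. Along the sequence `r n = m (n / 2) ^ k - M`, which grows like
`n ^ k`, the tail exponent therefore satisfies `I (r n) = O(n log n)`. If `I r` is eventually at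
least `c r ^ a`, then `n ^ (k a) = O(n log n)`, which is only possible if `k a ≤ 1`
(`mul_le_one_of_eventually_le`). The centring `M` does not affect the order of growth of `r n`.
-/

open Filter Asymptotics Topology

namespace PoissonUStat

theorem exists_ball_measure_pos {X : Type*} [PseudoMetricSpace X] [SecondCountableTopology X]
    [MeasurableSpace X] {μ : Measure X} (hμ : μ ≠ 0) {ε : ℝ} (hε : 0 < ε) :
    ∃ x, 0 < μ (Metric.ball x ε) := by
  by_contra! h
  refine hμ (Measure.measure_univ_eq_zero.mp (measure_null_of_locally_null _ fun x _ => ?_))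
  exact ⟨Metric.ball x ε, mem_nhdsWithin_of_mem_nhds (Metric.ball_mem_nhds x hε),
    nonpos_iff_eq_zero.mp (h x)⟩

/-- If `A` contains exactly `n` points of `ξ` and the kernel is at least `m` on all `k`-tuples in
`A`, then each of the `n (n - 1) ⋯ (n - k + 1)` injections of `Fin k` into these points
contributes at least `m` to the U-statistic. -/
theorem le_uStat_of_count_eq {d k n : ℕ} {f : (Fin k → EuclideanSpace ℝ (Fin d)) → ℝ}
    {m : ℝ} {A : Set (EuclideanSpace ℝ (Fin d))} (hfA : ∀ x, (∀ i, x i ∈ A) → m ≤ f x)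
    {ξ : Config d} (hξ : ξ.count A = n) :
    (((n.descFactorial k : ℝ) * m : ℝ) : EReal) ≤ uStat f ξ := by
  have hfinite : (ξ.points ∩ A).Finite := Set.finite_of_encard_eq_coe hξ
  have := hfinite.fintype
  have hcard : Fintype.card ↥(ξ.points ∩ A) = n := by
    rw [Config.count, Set.encard_eq_coe_toFinset_card] at hξ
    rw [← Set.toFinset_card]
    exact_mod_cast hξ
  let e : (Fin k ↪ ↥(ξ.points ∩ A)) → ξ.distinctTuples k := fun g =>
    ⟨fun i => g i, fun i => (g i).2.1, Subtype.val_injective.comp g.injective⟩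
  have he : Function.Injective e := fun g g' h => by
    ext i : 2
    exact congrFun (congrArg Subtype.val h) i
  have key : ENNReal.ofReal ((n.descFactorial k : ℝ) * m) ≤
      ∑' x : ξ.distinctTuples k, ENNReal.ofReal (f x) := by
    calc ENNReal.ofReal ((n.descFactorial k : ℝ) * m)
        = ∑ _g : Fin k ↪ ↥(ξ.points ∩ A), ENNReal.ofReal m := by
          rw [Finset.sum_const, Finset.card_univ, Fintype.card_embedding_eq, hcard,
            Fintype.card_fin, ENNReal.ofReal_mul (by positivity), ENNReal.ofReal_natCast,
            nsmul_eq_mul]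
      _ ≤ ∑ g : Fin k ↪ ↥(ξ.points ∩ A), ENNReal.ofReal (f (e g)) :=
          Finset.sum_le_sum fun g _ => ENNReal.ofReal_le_ofReal (hfA _ fun i => (g i).2.2)
      _ = ∑' g : Fin k ↪ ↥(ξ.points ∩ A), ENNReal.ofReal (f (e g)) := (tsum_fintype _).symm
      _ ≤ ∑' x : ξ.distinctTuples k, ENNReal.ofReal (f x) :=
          ENNReal.tsum_comp_le_tsum_of_injective he fun x => ENNReal.ofReal (f x)
  calc (((n.descFactorial k : ℝ) * m : ℝ) : EReal)
      ≤ ((ENNReal.ofReal ((n.descFactorial k : ℝ) * m) : ℝ≥0∞) : EReal) := by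
        rw [EReal.coe_ennreal_ofReal]
        exact_mod_cast le_max_left _ _
    _ ≤ uStat f ξ := EReal.coe_ennreal_le_coe_ennreal_iff.mpr key

/-- For `n ≥ 2 k` each factor of the falling factorial of `n` is at least `n / 2`. -/
theorem half_pow_le_descFactorial {n k : ℕ} (h : 2 * k ≤ n) :
    ((n : ℝ) / 2) ^ k ≤ n.descFactorial k := by
  have h1 : ((n + 1 - k : ℕ) : ℝ) ^ k ≤ n.descFactorial k := by
    exact_mod_cast Nat.pow_sub_le_descFactorial n k
  refine le_trans (pow_le_pow_left₀ (by positivity) ?_ k) h1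
  rw [Nat.cast_sub (by omega)]
  have : (2 : ℝ) * k ≤ n := by exact_mod_cast h
  push_cast
  linarith

/-- Lower bound for Poisson probabilities, from `n! ≤ n ^ n`. -/
theorem exp_neg_le_poissonMeasure_singleton {l : NNReal} (hl : 0 < l) {n : ℕ} (hn : n ≠ 0) :
    ENNReal.ofReal (Real.exp (-(l + n * |Real.log l| + n * Real.log n))) ≤
      poissonMeasure l {n} := by
  have hl' : (0 : ℝ) < l := hl
  have hn' : (0 : ℝ) < n := by positivity
  rw [poissonMeasure_singleton]
  refine ENNReal.ofReal_le_ofReal ?_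
  have h1 : Real.exp (-(n * |Real.log l|)) ≤ (l : ℝ) ^ n := by
    rw [← Real.exp_log hl', ← Real.exp_nat_mul, Real.exp_le_exp, Real.log_exp]
    nlinarith [neg_abs_le (Real.log l)]
  have h2 : Real.exp (-(n * Real.log n)) ≤ 1 / (n.factorial : ℝ) := by
    rw [Real.exp_neg, Real.exp_nat_mul, Real.exp_log hn', ← one_div]
    exact one_div_le_one_div_of_le (by positivity) (by exact_mod_cast n.factorial_le_pow)
  calc Real.exp (-(l + n * |Real.log l| + n * Real.log n))
      = Real.exp (-l) * Real.exp (-(n * |Real.log l|)) * Real.exp (-(n * Real.log n)) := by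
        rw [← Real.exp_add, ← Real.exp_add]
        ring_nf
    _ ≤ Real.exp (-l) * (l : ℝ) ^ n * (1 / (n.factorial : ℝ)) := by gcongr
    _ = Real.exp (-l) * (l : ℝ) ^ n / n.factorial := by ring

/-- The left side grows like `n ^ (k a)`, and `n ^ b` with `b > 1` eventually exceeds every
multiple of `n log n`. -/
theorem mul_le_one_of_eventually_le {k : ℕ} (hk : k ≠ 0) {a c m A B M : ℝ} (ha : 0 < a)
    (hc : 0 < c) (hm : 0 < m)
    (h : ∀ᶠ n : ℕ in atTop,
      c * (m * ((n : ℝ) / 2) ^ k - M) ^ a ≤ A + n * B + n * Real.log n) :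
    k * a ≤ 1 := by
  by_contra! hka
  have hcast : Tendsto (fun n : ℕ => (n : ℝ)) atTop atTop := tendsto_natCast_atTop_atTop
  have hA : (fun _ : ℝ => A) =o[atTop] fun x : ℝ => x ^ (k * a) :=
    isLittleO_const_left.mpr <| Or.inr <|
      tendsto_norm_atTop_atTop.comp (tendsto_rpow_atTop (by linarith))
  have hid : (fun x : ℝ => x) =o[atTop] fun x : ℝ => x ^ (k * a) := by
    have := (isBigO_refl (fun x : ℝ => x) atTop).mul_isLittleO
      (isLittleO_const_left.mpr <| Or.inr <|
        tendsto_norm_atTop_atTop.comp (tendsto_rpow_atTop (sub_pos.mpr hka)) :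
        (fun _ : ℝ => (1 : ℝ)) =o[atTop] fun x : ℝ => x ^ (k * a - 1))
    refine this.congr' (.of_eq (by simp)) ?_
    filter_upwards [eventually_gt_atTop 0] with x hx
    rw [Real.rpow_sub_one hx.ne']
    field_simp
  have hB : (fun x : ℝ => x * B) =o[atTop] fun x : ℝ => x ^ (k * a) := by
    simpa only [mul_comm] using hid.const_mul_left B
  have hL : (fun x : ℝ => x * Real.log x) =o[atTop] fun x : ℝ => x ^ (k * a) := by
    have := (isBigO_refl (fun x : ℝ => x) atTop).mul_isLittleO
      (isLittleO_log_rpow_atTop (sub_pos.mpr hka))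
    refine this.congr' EventuallyEq.rfl ?_
    filter_upwards [eventually_gt_atTop 0] with x hx
    rw [Real.rpow_sub_one hx.ne']
    field_simp
  -- Half of `m (n / 2) ^ k` absorbs the constant `M`.
  set q : ℝ := m / 2 * (1 / 2) ^ k with hq
  have hq0 : 0 < q := by positivity
  have hM : ∀ᶠ n : ℕ in atTop, q * (n : ℝ) ^ k ≤ m * ((n : ℝ) / 2) ^ k - M := by
    have : Tendsto (fun n : ℕ => q * (n : ℝ) ^ k) atTop atTop :=
      ((tendsto_pow_atTop hk).comp hcast).const_mul_atTop hq0
    filter_upwards [this.eventually_ge_atTop M] with n hn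
    have : m * ((n : ℝ) / 2) ^ k = 2 * (q * (n : ℝ) ^ k) := by
      rw [hq, div_pow, div_pow]
      ring
    linarith
  have hsmall := hcast.eventually
    (((hA.add hB).add hL).bound (c := c * q ^ a / 2) (by positivity))
  obtain ⟨n, h1, h2, h3, h4⟩ :=
    (h.and (hM.and (hsmall.and (eventually_gt_atTop 0)))).exists
  have hn : (0 : ℝ) < n := by exact_mod_cast h4
  have hpos : 0 < (n : ℝ) ^ (k * a) := by positivity
  have h5 : q ^ a * (n : ℝ) ^ (k * a) ≤ (m * ((n : ℝ) / 2) ^ k - M) ^ a := by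
    rw [Real.rpow_mul hn.le, Real.rpow_natCast, ← Real.mul_rpow hq0.le (by positivity)]
    exact Real.rpow_le_rpow (by positivity) h2 ha.le
  rw [Real.norm_eq_abs, Real.norm_eq_abs, abs_of_pos hpos] at h3
  have h6 := (le_abs_self _).trans h3
  have h7 : 0 < c * q ^ a * (n : ℝ) ^ (k * a) := by positivity
  have h8 := mul_le_mul_of_nonneg_left h5 hc.le
  linarith

/-- Here `+∞` is allowed for the lower limit. -/
theorem exists_pos_eventually_mul_rpow_le {I : ℝ → ℝ} {a : ℝ}
    (h : 0 < liminf (fun r : ℝ => ((I r / r ^ a : ℝ) : EReal)) atTop) :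
    ∃ c : ℝ, 0 < c ∧ ∀ᶠ r in atTop, c * r ^ a ≤ I r := by
  obtain ⟨c, hc0, hc⟩ := EReal.lt_iff_exists_real_btwn.mp h
  refine ⟨c, by exact_mod_cast hc0, ?_⟩
  filter_upwards [eventually_lt_of_lt_liminf hc, eventually_gt_atTop 0] with r hr hr0
  exact (le_div_iff₀ (Real.rpow_pos_of_pos hr0 a)).mp (by exact_mod_cast hr.le)

end PoissonUStat

open PoissonUStat

theorem proposition3p5 {d k : ℕ} (hk : 1 ≤ k)
    {Ω : Type*} [MeasurableSpace Ω] (P : Measure Ω) [IsProbabilityMeasure P]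
    (μ : Measure (EuclideanSpace ℝ (Fin d))) [IsLocallyFiniteMeasure μ] [NullSingletonClass μ]
    (hμ : μ ≠ 0)
    (η : Ω → PoissonUStat.Config d) (hη : PoissonUStat.IsPoissonProcess P η μ)
    (f : (Fin k → EuclideanSpace ℝ (Fin d)) → ℝ) (hf : PoissonUStat.IsKernel f)
    (hfin : ∀ᵐ ω ∂P, PoissonUStat.uStat f (η ω) < ⊤)
    (ρF ΘF mF MF : ℝ) (hρ : 0 < ρF) (hΘ : 1 ≤ ΘF) (hm : 0 < mF) (hmM : mF ≤ MF)
    (hK1 : PoissonUStat.CondK1 f ρF) (hK2 : PoissonUStat.CondK2 f ρF ΘF)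
    (hK3 : PoissonUStat.CondK3 f mF MF)
    (M : ℝ)
    (hM : PoissonUStat.IsMean P (fun ω => PoissonUStat.uStat f (η ω)) M ∨
      PoissonUStat.IsMedian P (fun ω => PoissonUStat.uStat f (η ω)) M)
    (I : ℝ → ℝ)
    (hI : ∀ r : ℝ, 0 ≤ r →
      P {ω | ((M + r : ℝ) : EReal) ≤ PoissonUStat.uStat f (η ω)} ≤
        ENNReal.ofReal (Real.exp (-I r)))
    (a : ℝ) (ha : 0 < a)
    (hIa : 0 < Filter.liminf (fun r : ℝ => ((I r / r ^ a : ℝ) : EReal)) Filter.atTop) :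
    a ≤ 1 / (k : ℝ) := by
  obtain ⟨c, hc, hIc⟩ := exists_pos_eventually_mul_rpow_le hIa
  obtain ⟨z, hz⟩ := exists_ball_measure_pos hμ (half_pos hρ)
  set B := Metric.ball z (ρF / 2)
  have hBfin : μ B ≠ ∞ := Metric.isBounded_ball.measure_lt_top.ne
  set l : NNReal := (μ B).toNNReal
  have hl : 0 < l := ENNReal.toNNReal_pos hz.ne' hBfin
  have hfB : ∀ x : Fin k → EuclideanSpace ℝ (Fin d), (∀ i, x i ∈ B) → mF ≤ f x := by
    intro x hx
    refine (hK3 x (hK1 x (Metric.diam_le_of_forall_dist_le hρ.le ?_))).1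
    rintro _ ⟨i, rfl⟩ _ ⟨j, rfl⟩
    have hi := Metric.mem_ball.mp (hx i)
    have hj := Metric.mem_ball.mp (hx j)
    linarith [dist_triangle_right (x i) (x j) z]
  have hr : Tendsto (fun n : ℕ => mF * ((n : ℝ) / 2) ^ k - M) atTop atTop :=
    tendsto_atTop_add_const_right _ _ <| Tendsto.const_mul_atTop hm <|
      (tendsto_pow_atTop (by omega)).comp <|
        tendsto_natCast_atTop_atTop.atTop_div_const two_pos
  have hk0 : (0 : ℝ) < k := by exact_mod_cast hk
  rw [le_div_iff₀ hk0, mul_comm]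
  refine mul_le_one_of_eventually_le (A := l) (B := |Real.log l|) (M := M) (by omega) ha hc hm ?_
  filter_upwards [hr.eventually hIc, hr.eventually_ge_atTop 0, eventually_ge_atTop (2 * k)]
    with n hn hn0 hnk
  refine hn.trans ?_
  have hsub : {ω | (η ω).count B = (n : ℕ∞)} ⊆
      {ω | ((M + (mF * ((n : ℝ) / 2) ^ k - M) : ℝ) : EReal) ≤ uStat f (η ω)} := by
    intro ω hω
    refine le_trans ?_ (le_uStat_of_count_eq hfB hω)
    rw [EReal.coe_le_coe_iff]
    linarith [mul_le_mul_of_nonneg_left (half_pow_le_descFactorial hnk) hm.le]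
  have hprob := ((exp_neg_le_poissonMeasure_singleton hl (n := n) (by omega)).trans_eq
    (hη.prob_count_eq B measurableSet_ball hBfin n).symm).trans
    ((measure_mono hsub).trans (hI _ hn0))
  rw [ENNReal.ofReal_le_ofReal_iff (Real.exp_pos _).le, Real.exp_le_exp] at hprob
  linarith
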